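/- Let $m\ge 2$ and $k\ge 1$ be integers, and let $B$ be the closed Euclidean unit ball of $\mathbb R^m$ centered at the origin. Let $\mu$ be a probability measure on $B$ such that (a1) $\mu$ is invariant under rotations about the origin; (a2) every relatively open subset of $B$ containing the origin has positive $\mu$-measure; (a3) every subset of $B$ of Lebesgue measure zero has $\mu$-measure zero. Assume that $\mu$ has a density $f$ with respect to Lebesgue measure on $B$ such that $f(x_1)>f(x_2)$ for all $x_1,x_2\in B$ with $\|x_1\|<\|x_2\|$. Let $c_1,\dots,c_k\in\mathbb R^m$ satisfy $\|c_i-c_j\|>2$ for all $i\ne j$. For $n\ge 1$, draw independent vectors $v^{(i)}_\ell$ ($1\le i\le k$, $1\le \ell\le n$) according to $\mu$, and let $P$ be the collection of the $kn$ points $x^{(i)}_\ell=c_i+v^{(i)}_\ell$ (stochastic ball model); $x^{(i)}_\ell$ is said to be drawn from the $i$-th ball. Consider the $k$-median linear program $$\min \sum_{p,q\in P}\|p-q\|\,z_{pq}\quad\text{s.t.}\quad \sum_{p\in P}z_{pq}=1\ \ \forall q\in P,\qquad z_{pq}\le y_p\ \ \forall p,q\in P,\qquad \sum_{p\in P}y_p=k,\qquad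 y_p,z_{pq}\ge 0\ \ \forall p,q\in P .$$ Say that it achieves exact recovery if it has a unique optimal solution $(y,z)$, all entries of this solution are in $\{0,1\}$, and it assigns each point to the ball from which it is drawn, that is, $z_{pq}=1$ if and only if $y_p=1$ and $p,q$ are drawn from the same ball. Then the linear program achieves exact recovery with high probability: for every $\delta\in(0,1)$ there is $N$ such that for every $n>N$ the probability of exact recovery is greater than $1-\delta$. -/

import Mathlib

open MeasureTheory

namespace KMedian

section LP

variable {P : Type*} [Fintype P]

/-- The objective `∑_{p,q} d(p,q) z_{pq}` of the `k`-median integer program and of its linear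
programming relaxation. -/
noncomputable def objective (d : P → P → ℝ) (z : P → P → ℝ) : ℝ :=
  ∑ p, ∑ q, d p q * z p q

/-- Feasibility for the `k`-median linear programming relaxation (LP). -/
structure LPFeasible (k : ℕ) (y : P → ℝ) (z : P → P → ℝ) : Prop where
  sum_assign : ∀ q, ∑ p, z p q = 1
  le_center : ∀ p q, z p q ≤ y p
  sum_center : ∑ p, y p = k
  center_nonneg : ∀ p, 0 ≤ y p
  assign_nonneg : ∀ p q, 0 ≤ z p q

/-- Feasibility for the `k`-median integer program (IP). -/
structure IPFeasible (k : ℕ) (y : P → ℝ) (z : P → P → ℝ) : Prop where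
  sum_assign : ∀ q, ∑ p, z p q = 1
  le_center : ∀ p q, z p q ≤ y p
  sum_center : ∑ p, y p = k
  center_binary : ∀ p, y p = 0 ∨ y p = 1
  assign_binary : ∀ p q, z p q = 0 ∨ z p q = 1

/-- `(y, z)` is an optimal solution of (LP). -/
def LPOptimal (k : ℕ) (d : P → P → ℝ) (y : P → ℝ) (z : P → P → ℝ) : Prop :=
  LPFeasible k y z ∧ ∀ y' z', LPFeasible k y' z' → objective d z ≤ objective d z'

/-- Exact recovery: (LP) has a unique optimal solution `(y, z)`, this solution is feasible to (IP),
and it assigns each point to the ball from which it is drawn, i.e. a point `q` is assigned to `p`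
exactly when `p` is a chosen center drawn from the same ball as `q`. Here `ball p` is the index of
the ball from which the point `p` is drawn. -/
def ExactRecovery {k : ℕ} (d : P → P → ℝ) (ball : P → Fin k) : Prop :=
  ∃ y z, LPOptimal k d y z ∧ (∀ y' z', LPOptimal k d y' z' → y' = y ∧ z' = z) ∧
    IPFeasible k y z ∧ ∀ p q, z p q = 1 ↔ y p = 1 ∧ ball p = ball q

end LP

section Model

variable {m : ℕ}

/-- (a1): `μ` is invariant under rotations centered in the origin (the orthogonal maps of
determinant `1`). -/
def RotationInvariant (μ : Measure (EuclideanSpace ℝ (Fin m))) : Prop :=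
  ∀ f : EuclideanSpace ℝ (Fin m) ≃ₗᵢ[ℝ] EuclideanSpace ℝ (Fin m),
    LinearMap.det (f.toLinearEquiv : EuclideanSpace ℝ (Fin m) →ₗ[ℝ] EuclideanSpace ℝ (Fin m)) = 1 →
      μ.map f = μ

/-- (a2): every relatively open subset of the unit ball containing the origin has positive
measure. -/
def PositiveNearCenter (μ : Measure (EuclideanSpace ℝ (Fin m))) : Prop :=
  ∀ U : Set (EuclideanSpace ℝ (Fin m)), IsOpen U → 0 ∈ U → 0 < μ (U ∩ Metric.closedBall 0 1)

/-- (a3): every subset of the unit ball of zero Lebesgue measure has zero measure. -/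
def NullOnLebesgueNull (μ : Measure (EuclideanSpace ℝ (Fin m))) : Prop :=
  ∀ S : Set (EuclideanSpace ℝ (Fin m)), S ⊆ Metric.closedBall 0 1 → volume S = 0 → μ S = 0

/-- The joint law of the `k * n` i.i.d. vectors `v i ℓ` drawn according to `μ`, indexed by pairs
`(i, ℓ)`. -/
noncomputable def sampleLaw (k n : ℕ) (μ : Measure (EuclideanSpace ℝ (Fin m))) :
    Measure (Fin k × Fin n → EuclideanSpace ℝ (Fin m)) :=
  Measure.pi fun _ => μ

/-- The data points `x i ℓ = c i + v i ℓ` of the stochastic ball model. -/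
def sbmPoint {k n : ℕ} (c : Fin k → EuclideanSpace ℝ (Fin m))
    (v : Fin k × Fin n → EuclideanSpace ℝ (Fin m)) (p : Fin k × Fin n) :
    EuclideanSpace ℝ (Fin m) :=
  c p.1 + v p

/-- The event that (LP) achieves exact recovery on the data points of the stochastic ball model. -/
def recoveryEvent {k : ℕ} (n : ℕ) (c : Fin k → EuclideanSpace ℝ (Fin m)) :
    Set (Fin k × Fin n → EuclideanSpace ℝ (Fin m)) :=
  {v | ExactRecovery (fun p q => dist (sbmPoint c v p) (sbmPoint c v q))
    (fun p : Fin k × Fin n => p.1)}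

end Model

/-- `A n` happens with high probability: for every `δ ∈ (0,1)`, the probability of `A n` exceeds
`1 - δ` for all large `n`. It is written as `Pr (complement of A n) < δ`: the same for events,
and for sets not known to be measurable it bounds the outer measure of the exceptional set. -/
def WithHighProbability {Ω : ℕ → Type*} [∀ n, MeasurableSpace (Ω n)]
    (Pr : ∀ n, Measure (Ω n)) (A : ∀ n, Set (Ω n)) : Prop :=
  ∀ δ : ℝ, 0 < δ → δ < 1 → ∃ N : ℕ, ∀ n, N < n → Pr n (A n)ᶜ < ENNReal.ofReal δ

end KMedian

/-! Recovery is certified by LP duality. Each ball `i` gets one dual price `α i`, and a point `p`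
collects the value `∑_q (α (ball q) - d p q)⁺`. If this value is maximal exactly at one point `s i`
per ball, with a common maximum `ω`, complementary slackness forces the intended solution
(`exactRecovery_of_dual`). The points `s i` are the sample medoids, and `α i` is tuned so that their
values agree exactly.

With `α = 1 + 2ε`, where `2 + 4ε` is a lower bound for the distances between centers, the value
divided by `n` is close to `∑_j g (x - c j)`, where `g x = E (α - ‖x - v‖)⁺`. The geometric core is
that this sum is below `g 0` away from the centers. By layer cake in the radius and in the density,
it reduces to volumes of balls cut by superlevel sets of the density. These sets are centered balls
up to their boundary, so disjointness suffices (`sum_measure_ball_inter_closedBall_le`); strict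
decrease gives strictness, and compactness a uniform gap `γ`.

A law of large numbers, uniform over a compact set, transfers the gap to samples. Close to a center,
a point sees its whole ball and nothing of the others, so its value orders points by total distance
within the ball. The medoid is the unique maximizer because ties have probability zero. -/

/-! ### Deterministic part: duality and conditions on the sample -/

/-- Dual certificate: the value `∑_q (α_q - d(p,q))⁺` equals `ω` at the selected points `s i` and is
smaller elsewhere. -/
theorem exactRecovery_of_dual {P : Type*} [Fintype P] {k : ℕ} (d : P → P → ℝ) (ball : P → Fin k)
    (s : Fin k → P) (hs : ∀ i, ball (s i) = i) (α : Fin k → ℝ) (ω : ℝ)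
    (hin : ∀ i q, ball q = i → d (s i) q ≤ α i)
    (hout : ∀ i q, ball q ≠ i → α (ball q) < d (s i) q)
    (hω : ∀ i, ∑ q, max (α (ball q) - d (s i) q) 0 = ω)
    (hlt : ∀ p, (∀ i, p ≠ s i) → ∑ q, max (α (ball q) - d p q) 0 < ω) :
    KMedian.ExactRecovery d ball := by
  classical
  have hω0 : ∀ p, ∑ q, max (α (ball q) - d p q) 0 ≤ ω := by
    intro p
    by_cases h : ∃ i, p = s i
    · obtain ⟨i, rfl⟩ := h
      exact (hω i).le
    · push Not at h
      exact (hlt p h).le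
  have hterm : ∀ y z, KMedian.LPFeasible k y z → ∀ p q,
      (α (ball q) - d p q) * z p q ≤ max (α (ball q) - d p q) 0 * y p := by
    intro y z h p q
    calc (α (ball q) - d p q) * z p q ≤ max (α (ball q) - d p q) 0 * z p q :=
          mul_le_mul_of_nonneg_right (le_max_left _ _) (h.assign_nonneg p q)
      _ ≤ _ := mul_le_mul_of_nonneg_left (h.le_center p q) (le_max_right _ _)
  have hrow : ∀ y z, KMedian.LPFeasible k y z → ∀ p,
      ∑ q, (α (ball q) - d p q) * z p q ≤ (∑ q, max (α (ball q) - d p q) 0) * y p := by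
    intro y z h p
    rw [Finset.sum_mul]
    exact Finset.sum_le_sum fun q _ => hterm y z h p q
  have hrow' : ∀ y z, KMedian.LPFeasible k y z → ∀ p,
      0 ≤ ω * y p - ∑ q, (α (ball q) - d p q) * z p q := by
    intro y z h p
    have h1 := hrow y z h p
    have h2 := mul_le_mul_of_nonneg_right (hω0 p) (h.center_nonneg p)
    linarith
  -- The objective is the dual value plus row slacks that are nonnegative by `hrow'`; optimality and
  -- uniqueness are both read off from these slacks.
  have hobj : ∀ y z, KMedian.LPFeasible k y z → KMedian.objective d z =
      (∑ q, α (ball q) - ω * k) + ∑ p, (ω * y p - ∑ q, (α (ball q) - d p q) * z p q) := by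
    intro y z h
    have h1 : ∑ p, ∑ q, α (ball q) * z p q = ∑ q, α (ball q) := by
      rw [Finset.sum_comm]
      refine Finset.sum_congr rfl fun q _ => ?_
      rw [← Finset.mul_sum, h.sum_assign, mul_one]
    have h2 : ∑ p, ω * y p = ω * k := by rw [← Finset.mul_sum, h.sum_center]
    simp only [KMedian.objective, sub_mul, Finset.sum_sub_distrib, h1, h2]
    ring
  set y₀ : P → ℝ := fun p => if p = s (ball p) then 1 else 0 with hy₀
  set z₀ : P → P → ℝ := fun p q => if p = s (ball q) then 1 else 0 with hz₀
  have hsinj : ∀ i j, s i = s j ↔ i = j := fun i j =>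
    ⟨fun h => by rw [← hs i, ← hs j, h], fun h => by rw [h]⟩
  have hys : ∀ i, y₀ (s i) = 1 := fun i => by simp [hy₀, hs]
  have hyn : ∀ p, (∀ i, p ≠ s i) → y₀ p = 0 := fun p h => by simp [hy₀, h]
  have hsum : ∀ f : P → ℝ, (∀ p, (∀ i, p ≠ s i) → f p = 0) → ∑ p, f p = ∑ i, f (s i) := by
    intro f hf
    have hi : Function.Injective s := fun i j h => (hsinj i j).1 h
    rw [← Finset.sum_image (s := Finset.univ) (g := s) (f := f) (fun i _ j _ h => hi h)]
    refine (Finset.sum_subset (Finset.subset_univ _) fun p _ hp => hf p ?_).symm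
    intro i h
    exact hp (Finset.mem_image.2 ⟨i, Finset.mem_univ _, h.symm⟩)
  have hfeas : KMedian.LPFeasible k y₀ z₀ := by
    refine ⟨fun q => by simp [hz₀], fun p q => ?_, ?_, fun p => ?_, fun p q => ?_⟩
    · by_cases h : p = s (ball q)
      · rw [h, hys]
        simp [hz₀]
      · simp only [hz₀, h, if_false, hy₀]
        split_ifs <;> norm_num
    · rw [hsum y₀ hyn]
      simp [hys]
    · simp only [hy₀]; split_ifs <;> norm_num
    · simp only [hz₀]; split_ifs <;> norm_num
  have hzero : ∀ p, ω * y₀ p - ∑ q, (α (ball q) - d p q) * z₀ p q = 0 := by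
    intro p
    by_cases h : ∃ i, p = s i
    · obtain ⟨i, rfl⟩ := h
      rw [hys, ← hω i, mul_one, sub_eq_zero]
      refine Finset.sum_congr rfl fun q _ => ?_
      by_cases hq : ball q = i
      · have h1 := hin i q hq
        simp [hz₀, hq, h1]
      · have h1 := hout i q hq
        have h2 : ¬ s i = s (ball q) := fun h => hq ((hsinj _ _).1 h).symm
        simp [hz₀, h2, h1.le]
    · push Not at h
      simp [hyn p h, hz₀, h]
  have hval : KMedian.objective d z₀ = ∑ q, α (ball q) - ω * k := by
    rw [hobj _ _ hfeas, Finset.sum_eq_zero fun p _ => hzero p, add_zero]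
  have hopt : KMedian.LPOptimal k d y₀ z₀ := by
    refine ⟨hfeas, fun y z h => ?_⟩
    rw [hval, hobj y z h]
    linarith [Finset.sum_nonneg fun p (_ : p ∈ Finset.univ) => hrow' y z h p]
  refine ⟨y₀, z₀, hopt, ?_, ⟨hfeas.sum_assign, hfeas.le_center, hfeas.sum_center, fun p => ?_,
    fun p q => ?_⟩, fun p q => ?_⟩
  · intro y z ⟨h, hmin⟩
    -- An optimal solution has zero slack in every row. Strictness in `hlt` then removes all centers
    -- but the `s i`, and strictness in `hout` removes assignments across balls.
    have h0 : ∑ p, (ω * y p - ∑ q, (α (ball q) - d p q) * z p q) = 0 := by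
      have h1 := hmin y₀ z₀ hfeas
      rw [hval, hobj y z h] at h1
      linarith [Finset.sum_nonneg fun p (_ : p ∈ Finset.univ) => hrow' y z h p]
    have h1 : ∀ p, ω * y p - ∑ q, (α (ball q) - d p q) * z p q = 0 := fun p =>
      (Finset.sum_eq_zero_iff_of_nonneg fun p _ => hrow' y z h p).1 h0 p (Finset.mem_univ p)
    have hy0 : ∀ p, (∀ i, p ≠ s i) → y p = 0 := by
      intro p hp
      have h2 := hrow y z h p
      have h3 := h1 p
      have h4 := hlt p hp
      nlinarith [h.center_nonneg p]
    have hz0 : ∀ p q, (∀ i, p ≠ s i) → z p q = 0 := fun p q hp =>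
      le_antisymm ((h.le_center p q).trans (hy0 p hp).le) (h.assign_nonneg p q)
    have hzs : ∀ i q, ball q ≠ i → z (s i) q = 0 := by
      intro i q hq
      have h2 : ∑ q, (max (α (ball q) - d (s i) q) 0 * y (s i)
          - (α (ball q) - d (s i) q) * z (s i) q) = 0 := by
        rw [Finset.sum_sub_distrib, ← Finset.sum_mul, hω]
        exact h1 (s i)
      have h3 := (Finset.sum_eq_zero_iff_of_nonneg fun q _ =>
        sub_nonneg.2 (hterm y z h (s i) q)).1 h2 q (Finset.mem_univ q)
      have h4 := hout i q hq
      rw [max_eq_right (by linarith), zero_mul, zero_sub, neg_eq_zero] at h3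
      rcases mul_eq_zero.1 h3 with h5 | h5
      · linarith
      · exact h5
    have hz1 : ∀ q, z (s (ball q)) q = 1 := by
      intro q
      refine (Finset.sum_eq_single_of_mem (f := fun p => z p q) (s (ball q)) (Finset.mem_univ _)
        fun p _ hp => ?_).symm.trans (h.sum_assign q)
      by_cases hh : ∃ i, p = s i
      · obtain ⟨i, rfl⟩ := hh
        exact hzs i q fun h => hp (by rw [h])
      · push Not at hh
        exact hz0 p q hh
    have hzz : z = z₀ := by
      ext p q
      by_cases hpq : p = s (ball q)
      · rw [hpq, hz1]
        simp [hz₀]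
      · rw [show z₀ p q = 0 by simp [hz₀, hpq]]
        by_cases hh : ∃ i, p = s i
        · obtain ⟨i, rfl⟩ := hh
          exact hzs i q fun h => hpq (by rw [h])
        · push Not at hh
          exact hz0 p q hh
    refine ⟨?_, hzz⟩
    have hge : ∀ i, 1 ≤ y (s i) := by
      intro i
      have := hz1 (s i)
      rw [hs] at this
      exact this ▸ h.le_center _ _
    have hsy : ∑ i, (y (s i) - 1) = 0 := by
      have := h.sum_center
      rw [hsum y hy0] at this
      simp [this]
    have hy1 : ∀ i, y (s i) - 1 = 0 := fun i =>
      (Finset.sum_eq_zero_iff_of_nonneg fun i _ => sub_nonneg.2 (hge i)).1 hsy i (Finset.mem_univ i)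
    ext p
    by_cases hh : ∃ i, p = s i
    · obtain ⟨i, rfl⟩ := hh
      rw [hys]
      linarith [hy1 i]
    · push Not at hh
      rw [hy0 p hh, hyn p hh]
  · simp only [hy₀]; split_ifs <;> simp
  · simp only [hz₀]; split_ifs <;> simp
  · simp only [hz₀, hy₀, ite_eq_left_iff, zero_ne_one, imp_false, not_not]
    constructor
    · intro h
      have hb : ball p = ball q := by rw [h, hs]
      exact ⟨hb ▸ h, hb⟩
    · rintro ⟨h, hb⟩
      exact hb ▸ h

/-- Deterministic conditions on the sample under which exact recovery holds. Here `g` plays the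
role of the population function `x ↦ E (α - ‖x - v‖)⁺` with `α = 1 + 2ε`. -/
theorem mem_recoveryEvent_of_approx {m k n : ℕ} (hn : 0 < n)
    (c : Fin k → EuclideanSpace ℝ (Fin m)) (v : Fin k × Fin n → EuclideanSpace ℝ (Fin m))
    (g : EuclideanSpace ℝ (Fin m) → ℝ) {ε η γ : ℝ}
    (hηε : 2 * η < ε) (hη : 0 < η) (hγ : 3 * k * η < γ)
    (hsep : ∀ i j, i ≠ j → 2 + 4 * ε ≤ dist (c i) (c j))
    (hv : ∀ q, ‖v q‖ ≤ 1)
    (hunif : ∀ i j h x, ‖x - (c j - c h)‖ ≤ 1 →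
      |∑ l, max (1 + 2 * ε - ‖x - v (i, l)‖) 0 - n * g x| ≤ n * η)
    (hnear : ∀ i, ∃ l, ‖v (i, l)‖ ≤ η)
    (hg0 : ∀ x, g x ≤ g 0)
    (hgap : ∀ x i, ‖x - c i‖ ≤ 1 → ε ≤ ‖x - c i‖ → ∑ j, g (x - c j) ≤ g 0 - γ)
    (htie : ∀ i l l', l ≠ l' →
      ∑ l'', ‖v (i, l) - v (i, l'')‖ ≠ ∑ l'', ‖v (i, l') - v (i, l'')‖) :
    v ∈ KMedian.recoveryEvent n c := by
  have hε : 0 < ε := by linarith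
  have hn' : (0 : ℝ) < n := Nat.cast_pos.2 hn
  have : Nonempty (Fin n) := ⟨⟨0, hn⟩⟩
  set cost : Fin k → Fin n → ℝ := fun i l => ∑ l'', ‖v (i, l) - v (i, l'')‖ with hcost
  choose s hs using fun i => Finite.exists_min (cost i)
  -- This choice makes the untruncated sum `∑_l (α i - ‖v (i, s i) - v (i, l)‖)` equal to `n * g 0`
  -- in every ball, which is the common `ω`.
  set α : Fin k → ℝ := fun i => g 0 + cost i (s i) / n with hα
  have hnα : ∀ i, n * α i = n * g 0 + cost i (s i) := by
    intro i
    simp only [hα]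
    field_simp
  have hunif0 : ∀ i x, ‖x‖ ≤ 1 →
      |∑ l, max (1 + 2 * ε - ‖x - v (i, l)‖) 0 - n * g x| ≤ n * η := by
    intro i x hx
    exact hunif i i i x (by simpa using hx)
  have hα1 : ∀ i, 1 + 2 * ε - η ≤ α i := by
    intro i
    have h1 := abs_le.1 (hunif0 i (v (i, s i)) (hv _))
    have h2 : ∑ l, (1 + 2 * ε - ‖v (i, s i) - v (i, l)‖) ≤
        ∑ l, max (1 + 2 * ε - ‖v (i, s i) - v (i, l)‖) 0 :=
      Finset.sum_le_sum fun l _ => le_max_left _ _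
    rw [Finset.sum_sub_distrib] at h2
    simp only [Finset.sum_const, Finset.card_univ, Fintype.card_fin, nsmul_eq_mul] at h2
    have h3 := mul_le_mul_of_nonneg_left (hg0 (v (i, s i))) hn'.le
    have h4 := hnα i
    have : n * (1 + 2 * ε - η) ≤ n * α i := by
      simp only [hcost] at h4
      linarith
    exact le_of_mul_le_mul_left this hn'
  -- Compare the medoid with a sample point within `η` of the center; at the center itself the
  -- truncation is inactive.
  have hα2 : ∀ i, α i ≤ 1 + 2 * ε + 2 * η := by
    intro i
    obtain ⟨l₀, hl₀⟩ := hnear i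
    have h1 := abs_le.1 (hunif0 i 0 (by simp))
    have h2 : ∑ l, max (1 + 2 * ε - ‖0 - v (i, l)‖) 0 = ∑ l, (1 + 2 * ε - ‖v (i, l)‖) := by
      refine Finset.sum_congr rfl fun l _ => ?_
      rw [zero_sub, norm_neg, max_eq_left]
      linarith [hv (i, l)]
    rw [h2, Finset.sum_sub_distrib] at h1
    have h3 : cost i l₀ ≤ ∑ l, (η + ‖v (i, l)‖) := by
      refine Finset.sum_le_sum fun l _ => (norm_sub_le _ _).trans ?_
      linarith
    rw [Finset.sum_add_distrib] at h3
    simp only [Finset.sum_const, Finset.card_univ, Fintype.card_fin, nsmul_eq_mul] at h1 h3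
    have h4 := hnα i
    have h5 := hs i l₀
    have : n * α i ≤ n * (1 + 2 * ε + 2 * η) := by linarith
    exact le_of_mul_le_mul_left this hn'
  set d : Fin k × Fin n → Fin k × Fin n → ℝ :=
    fun p q => dist (KMedian.sbmPoint c v p) (KMedian.sbmPoint c v q) with hd
  have hdin : ∀ p q : Fin k × Fin n, q.1 = p.1 → d p q = ‖v p - v q‖ := by
    intro p q h
    simp only [hd, KMedian.sbmPoint, dist_eq_norm, h]
    congr 1
    abel
  have hdfar : ∀ p q : Fin k × Fin n, q.1 ≠ p.1 → 2 + 4 * ε - ‖v p‖ - ‖v q‖ ≤ d p q := by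
    intro p q h
    have h1 := hsep _ _ h.symm
    have h2 : ‖c p.1 - c q.1‖ ≤ d p q + ‖v p‖ + ‖v q‖ := by
      have : c p.1 - c q.1 = (c p.1 + v p - (c q.1 + v q)) - v p + v q := by abel
      rw [this]
      refine (norm_add_le _ _).trans ?_
      gcongr
      refine (norm_sub_le _ _).trans ?_
      simp [hd, KMedian.sbmPoint, dist_eq_norm]
    rw [← dist_eq_norm] at h2
    linarith
  set C : Fin k × Fin n → ℝ := fun p => ∑ q : Fin k × Fin n, max (α q.1 - d p q) 0 with hC
  -- A point within `ε` of its center has distances below `1 + ε` inside its ball and above `1 + 3ε`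
  -- to other balls. As `2η < ε`, every `α i` lies between these bounds.
  have hnearin : ∀ p q : Fin k × Fin n, ‖v p‖ < ε → q.1 = p.1 → d p q ≤ α q.1 := by
    intro p q hp h
    rw [hdin p q h]
    have := norm_sub_le (v p) (v q)
    linarith [hα1 q.1, hv q]
  have hnearout : ∀ p q : Fin k × Fin n, ‖v p‖ < ε → q.1 ≠ p.1 → α q.1 < d p q := by
    intro p q hp h
    linarith [hdfar p q h, hα2 q.1, hv q]
  have hCnear : ∀ i l, ‖v (i, l)‖ < ε → C (i, l) = n * g 0 + cost i (s i) - cost i l := by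
    intro i l hp
    simp only [hC]
    rw [Fintype.sum_prod_type, Finset.sum_eq_single i]
    · rw [← hnα, hcost]
      have : ∑ l' : Fin n, (α i - ‖v (i, l) - v (i, l')‖) = n * α i - ∑ l', ‖v (i, l) - v (i, l')‖ := by
        rw [Finset.sum_sub_distrib]
        simp
      rw [← this]
      refine Finset.sum_congr rfl fun l' _ => ?_
      have h1 := hnearin (i, l) (i, l') hp rfl
      rw [max_eq_left (sub_nonneg.2 h1), hdin (i, l) (i, l') rfl]
    · intro j _ hj
      refine Finset.sum_eq_zero fun l' _ => max_eq_right ?_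
      linarith [hnearout (i, l) (j, l') hp hj]
    · simp
  -- Each ball costs `nη` for sampling and `2nη` for replacing `α j` by `1 + 2ε`; the total `3knη`
  -- is less than `nγ`.
  have hCfar : ∀ i l, ε ≤ ‖v (i, l)‖ → C (i, l) < n * g 0 := by
    intro i l hp
    have h1 : C (i, l) ≤ ∑ j, (n * g (c i + v (i, l) - c j) + n * η + n * (2 * η)) := by
      simp only [hC]
      rw [Fintype.sum_prod_type]
      refine Finset.sum_le_sum fun j _ => ?_
      have h2 := (abs_le.1 (hunif j i j (c i + v (i, l) - c j) (by
        rw [show c i + v (i, l) - c j - (c i - c j) = v (i, l) by abel]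
        exact hv _))).2
      have h3 : ∑ l', max (α j - d (i, l) (j, l')) 0 ≤
          ∑ l', (max (1 + 2 * ε - ‖c i + v (i, l) - c j - v (j, l')‖) 0 + 2 * η) := by
        refine Finset.sum_le_sum fun l' _ => ?_
        have h4 : d (i, l) (j, l') = ‖c i + v (i, l) - c j - v (j, l')‖ := by
          simp only [hd, KMedian.sbmPoint, dist_eq_norm]
          congr 1
          abel
        rw [h4]
        refine max_le ?_ ?_
        · linarith [hα2 j, le_max_left (1 + 2 * ε - ‖c i + v (i, l) - c j - v (j, l')‖) 0]
        · linarith [le_max_right (1 + 2 * ε - ‖c i + v (i, l) - c j - v (j, l')‖) 0]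
      rw [Finset.sum_add_distrib] at h3
      simp only [Finset.sum_const, Finset.card_univ, Fintype.card_fin, nsmul_eq_mul] at h3
      linarith
    have h2 := hgap (c i + v (i, l)) i (by simpa using hv _) (by simpa using hp)
    rw [Finset.sum_add_distrib, Finset.sum_add_distrib, ← Finset.mul_sum] at h1
    simp only [Finset.sum_const, Finset.card_univ, Fintype.card_fin, nsmul_eq_mul] at h1
    have h3 := mul_le_mul_of_nonneg_left h2 hn'.le
    have h4 := mul_lt_mul_of_pos_left hγ hn'
    linarith
  -- The medoid collects at least `n * g 0` from its own ball alone, so it cannot be far from the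
  -- center.
  have hsnear : ∀ i, ‖v (i, s i)‖ < ε := by
    intro i
    by_contra! h
    have h1 := hCfar i (s i) h
    have h2 : ∑ l', max (α i - d (i, s i) (i, l')) 0 ≤ C (i, s i) := by
      simp only [hC]
      rw [Fintype.sum_prod_type]
      exact Finset.single_le_sum (f := fun j => ∑ l', max (α j - d (i, s i) (j, l')) 0)
        (fun j _ => Finset.sum_nonneg fun _ _ => le_max_right _ _) (Finset.mem_univ i)
    have h3 : ∑ l' : Fin n, (α i - ‖v (i, s i) - v (i, l')‖) ≤
        ∑ l', max (α i - d (i, s i) (i, l')) 0 := by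
      refine Finset.sum_le_sum fun l' _ => ?_
      rw [hdin (i, s i) (i, l') rfl]
      exact le_max_left _ _
    rw [Finset.sum_sub_distrib] at h3
    simp only [Finset.sum_const, Finset.card_univ, Fintype.card_fin, nsmul_eq_mul, hnα, hcost] at h3
    linarith
  refine exactRecovery_of_dual d (fun p => p.1) (fun i => (i, s i)) (fun _ => rfl) α (n * g 0)
    (fun i q h => h ▸ hnearin (q.1, s q.1) q (hsnear _) rfl)
    (fun i q h => hnearout _ q (hsnear i) h)
    (fun i => (hCnear i _ (hsnear i)).trans (by ring)) ?_
  rintro ⟨i, l⟩ hp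
  rcases lt_or_ge ‖v (i, l)‖ ε with h | h
  · have h1 := hCnear i l h
    have hne : s i ≠ l := fun h => hp i (by rw [h])
    have h2 : cost i (s i) < cost i l := lt_of_le_of_ne (hs i l) (htie i _ _ hne)
    simp only [hC] at h1
    linarith
  · exact hCfar i l h

/-! ### Expected contributions and the gap away from the centers -/

section Population

open Metric Set
open scoped ENNReal

section MeanContribution

variable {E : Type*} [NormedAddCommGroup E] [MeasurableSpace E]

/-- The expected contribution `E (α - ‖x - v‖)⁺` of a ball to a point at position `x` relative to
its center. -/
noncomputable def meanContribution (μ : Measure E) (α : ℝ) (x : E) : ℝ :=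
  ∫ v, max (α - ‖x - v‖) 0 ∂μ

theorem meanContribution_nonneg (μ : Measure E) (α : ℝ) (x : E) : 0 ≤ meanContribution μ α x :=
  integral_nonneg fun _ => le_max_right _ _

theorem measurable_measure_ball_sub (μ : Measure E) (α : ℝ) (y : E) :
    Measurable fun t : ℝ => μ (ball y (α - t)) :=
  Antitone.measurable fun _ _ h => measure_mono (ball_subset_ball (by linarith))

theorem abs_contribution_sub_le {E : Type*} [NormedAddCommGroup E] (α : ℝ) (x y v : E) :
    |max (α - ‖x - v‖) 0 - max (α - ‖y - v‖) 0| ≤ ‖x - y‖ := by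
  refine (abs_max_sub_max_le_abs _ _ _).trans ?_
  rw [show α - ‖x - v‖ - (α - ‖y - v‖) = ‖y - v‖ - ‖x - v‖ by ring, norm_sub_rev x y]
  exact (abs_norm_sub_norm_le _ _).trans (by simp)

/-- Layer cake: for `t > 0`, the contribution exceeds `t` exactly on the open ball of radius `α - t`
about `x`. -/
theorem lintegral_max_sub_eq [BorelSpace E] (μ : Measure E) (α : ℝ) (x : E) :
    ∫⁻ v, ENNReal.ofReal (max (α - ‖x - v‖) 0) ∂μ = ∫⁻ t in Ioi (0 : ℝ), μ (ball x (α - t)) := by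
  rw [lintegral_eq_lintegral_meas_lt μ (f := fun v => max (α - ‖x - v‖) 0)
    (ae_of_all _ fun _ => le_max_right _ _)
    (by fun_prop)]
  refine setLIntegral_congr_fun measurableSet_Ioi fun t ht => ?_
  congr 1
  ext v
  have ht : ¬ t < 0 := not_lt.2 (le_of_lt ht)
  simp only [mem_ofPred_eq, lt_max_iff, ht, or_false, mem_ball, dist_comm v, dist_eq_norm]
  constructor <;> intro h <;> linarith

variable [NormedSpace ℝ E] [FiniteDimensional ℝ E] [BorelSpace E]

theorem integrable_contribution (μ : Measure E) [IsFiniteMeasure μ] (α : ℝ) (x : E) :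
    Integrable (fun v => max (α - ‖x - v‖) 0) μ := by
  refine Integrable.of_bound (by fun_prop) |α| (ae_of_all _ fun v => ?_)
  rw [Real.norm_of_nonneg (le_max_right _ _)]
  exact max_le (by linarith [le_abs_self α, norm_nonneg (x - v)]) (abs_nonneg _)

theorem abs_meanContribution_sub_le (μ : Measure E) [IsProbabilityMeasure μ] (α : ℝ) (x y : E) :
    |meanContribution μ α x - meanContribution μ α y| ≤ ‖x - y‖ := by
  unfold meanContribution
  rw [← integral_sub (integrable_contribution μ α x) (integrable_contribution μ α y)]
  refine (norm_integral_le_of_norm_le_const (μ := μ) (C := ‖x - y‖)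
    (f := fun v => max (α - ‖x - v‖) 0 - max (α - ‖y - v‖) 0)
    (ae_of_all _ fun v => abs_contribution_sub_le α x y v)).trans ?_
  simp

theorem continuous_meanContribution (μ : Measure E) [IsProbabilityMeasure μ] (α : ℝ) :
    Continuous (meanContribution μ α) := by
  refine LipschitzWith.continuous (K := 1) (LipschitzWith.of_dist_le_mul fun x y => ?_)
  simpa [dist_eq_norm] using abs_meanContribution_sub_le μ α x y

theorem ofReal_meanContribution (μ : Measure E) [IsProbabilityMeasure μ] (α : ℝ) (x : E) :
    ENNReal.ofReal (meanContribution μ α x) = ∫⁻ t in Ioi (0 : ℝ), μ (ball x (α - t)) := by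
  rw [← lintegral_max_sub_eq, meanContribution, ofReal_integral_eq_lintegral_ofReal
    (integrable_contribution μ α x) (ae_of_all _ fun _ => le_max_right _ _)]

theorem ofReal_sum_meanContribution {ι : Type*} [Fintype ι] (μ : Measure E) [IsProbabilityMeasure μ]
    (α : ℝ) (x : ι → E) :
    ENNReal.ofReal (∑ i, meanContribution μ α (x i))
      = ∫⁻ t in Ioi (0 : ℝ), ∑ i, μ (ball (x i) (α - t)) := by
  rw [ENNReal.ofReal_sum_of_nonneg fun i _ => meanContribution_nonneg μ α (x i),
    lintegral_finsetSum' _ fun i _ => (measurable_measure_ball_sub μ α (x i)).aemeasurable]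
  exact Finset.sum_congr rfl fun i _ => ofReal_meanContribution μ α (x i)

end MeanContribution

variable {E : Type*} [NormedAddCommGroup E] [NormedSpace ℝ E] [FiniteDimensional ℝ E]
  [Nontrivial E] [MeasurableSpace E] [BorelSpace E] {ι : Type*} [Fintype ι]

/-- Congruent disjoint balls of radius `s` meet a centered ball of radius `r ≤ 1` in total volume
at most that of the centered ball of radius `min s r`. -/
theorem sum_measure_ball_inter_closedBall_le (ν : Measure E) [ν.IsAddHaarMeasure] (x : ι → E)
    {s r : ℝ} (hr : r ≤ 1) (hs : ∀ i j, i ≠ j → 2 * s ≤ dist (x i) (x j))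
    (hx : ∀ i j, i ≠ j → 2 < dist (x i) (x j)) :
    ∑ i, ν (ball (x i) s ∩ closedBall 0 r) ≤ ν (ball 0 (min s r)) := by
  rcases le_total r s with h | h
  · rw [min_eq_right h, ← Measure.addHaar_closedBall_eq_addHaar_ball]
    calc ∑ i, ν (ball (x i) s ∩ closedBall 0 r)
        = ν (⋃ i, ball (x i) s ∩ closedBall 0 r) := by
          rw [measure_iUnion _ fun i => measurableSet_ball.inter measurableSet_closedBall,
            tsum_fintype]
          intro i j hij
          refine Disjoint.mono inter_subset_left inter_subset_left (ball_disjoint_ball ?_)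
          linarith [hs i j hij]
      _ ≤ _ := measure_mono (iUnion_subset fun i => inter_subset_right)
  · rw [min_eq_left h]
    -- Translation by `-x i` swaps the roles: one fixed ball of radius `s` is cut by closed balls of
    -- radius `r ≤ 1`, disjoint because their centers are more than `2` apart.
    have htrans : ∀ i, ν (ball (x i) s ∩ closedBall 0 r)
        = ν (ball 0 s ∩ closedBall (- x i) r) := by
      intro i
      rw [← measure_preimage_add ν (x i) (ball (x i) s ∩ closedBall 0 r)]
      congr 1
      ext y
      simp [dist_eq_norm, add_comm]
    calc ∑ i, ν (ball (x i) s ∩ closedBall 0 r)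
        = ν (⋃ i, ball 0 s ∩ closedBall (- x i) r) := by
          rw [measure_iUnion _ fun i => measurableSet_ball.inter measurableSet_closedBall,
            tsum_fintype]
          · exact Finset.sum_congr rfl fun i _ => htrans i
          · intro i j hij
            refine Disjoint.mono inter_subset_right inter_subset_right
              (closedBall_disjoint_closedBall ?_)
            rw [dist_neg_neg]
            linarith [hx i j hij]
      _ ≤ _ := measure_mono (iUnion_subset fun i => inter_subset_left)

/-- A radially decreasing superlevel set in the unit ball lies between the open and the closed ball
of some radius. -/
theorem exists_ball_subset_superlevel {E : Type*} [NormedAddCommGroup E] {p : E → ℝ≥0∞}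
    (hp : ∀ x₁ ∈ closedBall (0 : E) 1, ∀ x₂ ∈ closedBall (0 : E) 1, ‖x₁‖ < ‖x₂‖ → p x₂ < p x₁)
    (t : ℝ≥0∞) : ∃ r ≤ (1 : ℝ), ball 0 r ⊆ closedBall 0 1 ∩ {v | t < p v} ∧
      closedBall 0 1 ∩ {v | t < p v} ⊆ closedBall 0 r := by
  rcases (closedBall (0 : E) 1 ∩ {v | t < p v}).eq_empty_or_nonempty with h | h
  · exact ⟨0, zero_le_one, by simp, by simp [h]⟩
  set L := closedBall (0 : E) 1 ∩ {v | t < p v}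
  have hb : ∀ b ∈ norm '' L, b ≤ 1 := by
    rintro _ ⟨v, hv, rfl⟩
    simpa using hv.1
  refine ⟨sSup (norm '' L), csSup_le (h.image _) hb, fun v hv => ?_, fun v hv => ?_⟩
  · rw [mem_ball_zero_iff] at hv
    obtain ⟨_, ⟨w, hw, rfl⟩, hvw⟩ := exists_lt_of_lt_csSup (h.image _) hv
    have hv1 : v ∈ closedBall (0 : E) 1 := by
      rw [mem_closedBall_zero_iff]
      exact hvw.le.trans (hb _ ⟨w, hw, rfl⟩)
    exact ⟨hv1, lt_trans hw.2 (hp v hv1 w hw.1 hvw)⟩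
  · rw [mem_closedBall_zero_iff]
    exact le_csSup ⟨1, hb⟩ ⟨v, hv, rfl⟩

/-- Layer-cake formula for the measure with a given density. -/
theorem withDensity_restrict_apply_eq_lintegral {X : Type*} [MeasurableSpace X] (ν : Measure X)
    [SFinite ν] {p : X → ℝ≥0∞} (hp : Measurable p) {B A : Set X}
    (hA : MeasurableSet A) (hfin : (ν.restrict B).withDensity p univ ≠ ∞) :
    (ν.restrict B).withDensity p A
      = ∫⁻ t in Ioi (0 : ℝ), ν (A ∩ (B ∩ {v | ENNReal.ofReal t < p v})) := by
  rw [withDensity_apply _ hA, Measure.restrict_restrict hA]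
  rw [withDensity_apply _ MeasurableSet.univ, Measure.restrict_univ] at hfin
  have hlt : ∀ᵐ v ∂(ν.restrict B), p v < ∞ := ae_lt_top hp hfin
  have hlt' : ∀ᵐ v ∂(ν.restrict (A ∩ B)), p v < ∞ :=
    ae_mono (Measure.restrict_mono inter_subset_right le_rfl) hlt
  calc ∫⁻ v in A ∩ B, p v ∂ν = ∫⁻ v in A ∩ B, ENNReal.ofReal (p v).toReal ∂ν :=
        lintegral_congr_ae (hlt'.mono fun v hv => (ENNReal.ofReal_toReal hv.ne).symm)
    _ = ∫⁻ t in Ioi (0 : ℝ), ν.restrict (A ∩ B) {v | t < (p v).toReal} :=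
        lintegral_eq_lintegral_meas_lt _ (ae_of_all _ fun _ => ENNReal.toReal_nonneg)
          hp.ennreal_toReal.aemeasurable
    _ = _ := by
        refine setLIntegral_congr_fun measurableSet_Ioi fun t ht => ?_
        have h1 : ν.restrict (A ∩ B) {v | t < (p v).toReal}
            = ν.restrict (A ∩ B) {v | ENNReal.ofReal t < p v} := by
          refine measure_congr (hlt'.mono fun v hv => ?_)
          exact propext (ENNReal.ofReal_lt_iff_lt_toReal (le_of_lt ht) hv.ne).symm
        simp only [h1]
        rw [Measure.restrict_apply (measurableSet_lt measurable_const hp), inter_comm, inter_assoc]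

section Density

variable (ν : Measure E) [ν.IsAddHaarMeasure] {p : E → ℝ≥0∞} (x : ι → E) {s : ℝ}

theorem sum_measure_ball_inter_superlevel_le
    (hp : ∀ x₁ ∈ closedBall (0 : E) 1, ∀ x₂ ∈ closedBall (0 : E) 1, ‖x₁‖ < ‖x₂‖ → p x₂ < p x₁)
    (hs : ∀ i j, i ≠ j → 2 * s ≤ dist (x i) (x j))
    (hx : ∀ i j, i ≠ j → 2 < dist (x i) (x j)) (t : ℝ≥0∞) :
    ∑ i, ν (ball (x i) s ∩ (closedBall 0 1 ∩ {v | t < p v}))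
      ≤ ν (ball 0 s ∩ (closedBall 0 1 ∩ {v | t < p v})) := by
  obtain ⟨r, hr, h1, h2⟩ := exists_ball_subset_superlevel hp t
  calc ∑ i, ν (ball (x i) s ∩ (closedBall 0 1 ∩ {v | t < p v}))
      ≤ ∑ i, ν (ball (x i) s ∩ closedBall 0 r) :=
        Finset.sum_le_sum fun i _ => measure_mono (inter_subset_inter_right _ h2)
    _ ≤ ν (ball 0 (min s r)) := sum_measure_ball_inter_closedBall_le ν x hr hs hx
    _ ≤ _ := measure_mono (subset_inter (ball_subset_ball (min_le_left _ _))
        ((ball_subset_ball (min_le_right _ _)).trans h1))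

theorem sum_measure_ball_le (hpm : Measurable p)
    (hp : ∀ x₁ ∈ closedBall (0 : E) 1, ∀ x₂ ∈ closedBall (0 : E) 1, ‖x₁‖ < ‖x₂‖ → p x₂ < p x₁)
    (hfin : (ν.restrict (closedBall 0 1)).withDensity p univ ≠ ∞)
    (hs : ∀ i j, i ≠ j → 2 * s ≤ dist (x i) (x j))
    (hx : ∀ i j, i ≠ j → 2 < dist (x i) (x j)) :
    ∑ i, (ν.restrict (closedBall 0 1)).withDensity p (ball (x i) s)
      ≤ (ν.restrict (closedBall 0 1)).withDensity p (ball 0 s) := by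
  simp_rw [withDensity_restrict_apply_eq_lintegral ν hpm measurableSet_ball hfin]
  rw [← lintegral_finsetSum']
  · exact lintegral_mono fun t => sum_measure_ball_inter_superlevel_le ν x hp hs hx _
  · intro i _
    refine Measurable.aemeasurable (Antitone.measurable fun t t' htt' => ?_)
    refine measure_mono (inter_subset_inter_right _ (inter_subset_inter_right _ ?_))
    exact fun v hv => lt_of_le_of_lt (ENNReal.ofReal_le_ofReal htt') hv

/-- For levels between the values of `p` at norms `δ / 2` and `δ / 3`, the superlevel set lies
within norm `δ / 2`, hence misses every `ball (x i) s`, but contains the ball of radius `δ / 3`.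
Strict decrease of `p` yields a whole interval of such levels. -/
theorem sum_measure_ball_lt (hpm : Measurable p)
    (hp : ∀ x₁ ∈ closedBall (0 : E) 1, ∀ x₂ ∈ closedBall (0 : E) 1, ‖x₁‖ < ‖x₂‖ → p x₂ < p x₁)
    (hfin : (ν.restrict (closedBall 0 1)).withDensity p univ ≠ ∞)
    (hs : ∀ i j, i ≠ j → 2 * s ≤ dist (x i) (x j))
    (hx : ∀ i j, i ≠ j → 2 < dist (x i) (x j)) (hs0 : 0 < s) {δ : ℝ} (hδ : δ ≤ 1)
    (hsδ : s < δ / 2) (hδx : ∀ i, δ ≤ ‖x i‖) :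
    ∑ i, (ν.restrict (closedBall 0 1)).withDensity p (ball (x i) s)
      < (ν.restrict (closedBall 0 1)).withDensity p (ball 0 s) := by
  have hδ0 : 0 < δ := by linarith
  have hmeas : ∀ y : E, Measurable
      fun t : ℝ => ν (ball y s ∩ (closedBall 0 1 ∩ {v | ENNReal.ofReal t < p v})) := by
    intro y
    refine Antitone.measurable fun t t' htt' => ?_
    refine measure_mono (inter_subset_inter_right _ (inter_subset_inter_right _ ?_))
    exact fun v hv => lt_of_le_of_lt (ENNReal.ofReal_le_ofReal htt') hv
  have hle := sum_measure_ball_le ν x hpm hp hfin hs hx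
  have hne : ∑ i, (ν.restrict (closedBall 0 1)).withDensity p (ball (x i) s) ≠ ∞ :=
    ne_top_of_le_ne_top hfin (hle.trans (measure_mono (subset_univ _)))
  simp_rw [withDensity_restrict_apply_eq_lintegral ν hpm measurableSet_ball hfin] at hne ⊢
  rw [← lintegral_finsetSum' _ fun i _ => (hmeas _).aemeasurable] at hne ⊢
  obtain ⟨x₁, hx₁⟩ := exists_norm_eq E (by positivity : (0 : ℝ) ≤ δ / 3)
  obtain ⟨x₂, hx₂⟩ := exists_norm_eq E (by positivity : (0 : ℝ) ≤ δ / 2)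
  have hx₁1 : x₁ ∈ closedBall (0 : E) 1 := by
    rw [mem_closedBall_zero_iff]; linarith
  have hx₂1 : x₂ ∈ closedBall (0 : E) 1 := by
    rw [mem_closedBall_zero_iff]; linarith
  obtain ⟨t₂, ht₂, ht₂'⟩ := ENNReal.lt_iff_exists_real_btwn.1
    (hp x₁ hx₁1 x₂ hx₂1 (by rw [hx₁, hx₂]; linarith))
  obtain ⟨t₁, ht₁, ht₁'⟩ := ENNReal.lt_iff_exists_real_btwn.1 ht₂'.2
  have ht12 : t₂ < t₁ := (ENNReal.ofReal_lt_ofReal_iff_of_nonneg ht₂).1 ht₁'.1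
  refine lintegral_strict_mono_of_ae_le_of_ae_lt_on (s := Ioo t₂ t₁) (hmeas 0).aemeasurable hne
    (ae_of_all _ fun t => sum_measure_ball_inter_superlevel_le ν x hp hs hx _) ?_
    (ae_of_all _ fun t ht => ?_)
  · rw [Measure.restrict_apply measurableSet_Ioo, inter_eq_left.2]
    · simp [ht12]
    · exact fun t ht => lt_of_le_of_lt ht₂ ht.1
  · have h0 : ∑ i, ν (ball (x i) s ∩ (closedBall 0 1 ∩ {v | ENNReal.ofReal t < p v})) = 0 := by
      refine Finset.sum_eq_zero fun i _ => ?_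
      convert measure_empty (μ := ν)
      rw [← disjoint_iff_inter_eq_empty, disjoint_left]
      rintro v hv ⟨hv1, hvt⟩
      have h1 : ‖v‖ ≤ δ / 2 := by
        by_contra! h
        have h2 := hp x₂ hx₂1 v hv1 (by rw [hx₂]; exact h)
        have h3 := ht₂'.1.trans_le (ENNReal.ofReal_le_ofReal ht.1.le)
        exact lt_asymm (lt_trans hvt h2) h3
      rw [mem_ball, dist_eq_norm] at hv
      have h2 := hδx i
      have h3 := norm_sub_norm_le (x i) v
      rw [norm_sub_rev] at h3
      linarith
    simp only [h0]
    refine lt_of_lt_of_le (measure_ball_pos ν (0 : E) (show 0 < min s (δ / 3) by positivity))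
      (measure_mono fun v hv => ?_)
    rw [mem_ball_zero_iff, lt_min_iff] at hv
    have hv1 : v ∈ closedBall (0 : E) 1 := by
      rw [mem_closedBall_zero_iff]; linarith
    refine ⟨by simpa using hv.1, hv1, ?_⟩
    have h2 := hp v hv1 x₁ hx₁1 (by rw [hx₁]; exact hv.2)
    exact (lt_of_le_of_lt (ENNReal.ofReal_le_ofReal ht.2.le) ht₁'.2).trans h2

end Density

section Contribution

variable (ν : Measure E) [ν.IsAddHaarMeasure] {p : E → ℝ≥0∞} {μ : Measure E}
  [IsProbabilityMeasure μ] {α : ℝ}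

theorem sum_meanContribution_le (hpm : Measurable p)
    (hp : ∀ x₁ ∈ closedBall (0 : E) 1, ∀ x₂ ∈ closedBall (0 : E) 1, ‖x₁‖ < ‖x₂‖ → p x₂ < p x₁)
    (hμ : μ = (ν.restrict (closedBall 0 1)).withDensity p) (x : ι → E)
    (hs : ∀ i j, i ≠ j → 2 * α ≤ dist (x i) (x j))
    (hx : ∀ i j, i ≠ j → 2 < dist (x i) (x j)) :
    ∑ i, meanContribution μ α (x i) ≤ meanContribution μ α 0 := by
  rw [← ENNReal.ofReal_le_ofReal_iff (meanContribution_nonneg μ α 0), ofReal_sum_meanContribution,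
    ofReal_meanContribution]
  refine setLIntegral_mono' measurableSet_Ioi fun t ht => ?_
  have hfin : (ν.restrict (closedBall 0 1)).withDensity p univ ≠ ∞ := hμ ▸ measure_ne_top μ univ
  rw [hμ]
  refine sum_measure_ball_le ν x hpm hp hfin (fun i j hij => ?_) hx
  have := hs i j hij
  rw [mem_Ioi] at ht
  linarith

/-- The inequality between integrands is strict for `t` in `(α - δ / 2, α)`, that is, for radii `α -
t` below half the distance of the `x i` from the origin. The bounds `δ ≤ 1 ≤ α` keep this interval
in `t > 0`. -/
theorem sum_meanContribution_lt (hpm : Measurable p)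
    (hp : ∀ x₁ ∈ closedBall (0 : E) 1, ∀ x₂ ∈ closedBall (0 : E) 1, ‖x₁‖ < ‖x₂‖ → p x₂ < p x₁)
    (hμ : μ = (ν.restrict (closedBall 0 1)).withDensity p) (x : ι → E)
    (hα : 1 ≤ α)
    (hs : ∀ i j, i ≠ j → 2 * α ≤ dist (x i) (x j))
    (hx : ∀ i j, i ≠ j → 2 < dist (x i) (x j)) (hx0 : ∀ i, x i ≠ 0) :
    ∑ i, meanContribution μ α (x i) < meanContribution μ α 0 := by
  obtain ⟨δ, hδ0, hδ1, hδ⟩ : ∃ δ : ℝ, 0 < δ ∧ δ ≤ 1 ∧ ∀ i, δ ≤ ‖x i‖ := by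
    have h1 : ∀ᶠ δ : ℝ in nhdsWithin 0 (Ioi 0), δ ≤ 1 ∧ ∀ i, δ ≤ ‖x i‖ := by
      refine Filter.Eventually.filter_mono nhdsWithin_le_nhds ?_
      exact (eventually_le_nhds one_pos).and
        (Filter.eventually_all.2 fun i => eventually_le_nhds (norm_pos_iff.2 (hx0 i)))
    obtain ⟨δ, h2, h3⟩ := (h1.and self_mem_nhdsWithin).exists
    exact ⟨δ, h3, h2⟩
  have hfin : (ν.restrict (closedBall 0 1)).withDensity p univ ≠ ∞ := hμ ▸ measure_ne_top μ univ
  have key : ENNReal.ofReal (∑ i, meanContribution μ α (x i))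
      < ENNReal.ofReal (meanContribution μ α 0) := by
    have hne : ENNReal.ofReal (∑ i, meanContribution μ α (x i)) ≠ ∞ := ENNReal.ofReal_ne_top
    rw [ofReal_sum_meanContribution] at hne ⊢
    rw [ofReal_meanContribution]
    refine lintegral_strict_mono_of_ae_le_of_ae_lt_on (s := Ioo (α - δ / 2) α)
      (measurable_measure_ball_sub μ α 0).aemeasurable hne ?_ ?_ ?_
    · refine (ae_restrict_mem measurableSet_Ioi).mono fun t ht => ?_
      simp only [hμ]
      refine sum_measure_ball_le ν x hpm hp hfin (fun i j hij => ?_) hx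
      have := hs i j hij
      rw [mem_Ioi] at ht
      linarith
    · rw [Measure.restrict_apply measurableSet_Ioo, inter_eq_left.2]
      · simp [hδ0]
      · intro t ht
        rw [mem_Ioi]
        linarith [ht.1]
    · refine ae_of_all _ fun t ht => ?_
      simp only [hμ]
      refine sum_measure_ball_lt ν x hpm hp hfin (fun i j hij => ?_) hx (by linarith [ht.2]) hδ1
        (by linarith [ht.1]) hδ
      linarith [hs i j hij, ht.1]
  exact (ENNReal.ofReal_lt_ofReal_iff_of_nonneg
    (Finset.sum_nonneg fun i _ => meanContribution_nonneg μ α (x i))).1 key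

/-- Away from the centers the total expected contribution is smaller than at a center, uniformly. -/
theorem exists_gap_sum_meanContribution (hpm : Measurable p)
    (hp : ∀ x₁ ∈ closedBall (0 : E) 1, ∀ x₂ ∈ closedBall (0 : E) 1, ‖x₁‖ < ‖x₂‖ → p x₂ < p x₁)
    (hμ : μ = (ν.restrict (closedBall 0 1)).withDensity p) (c : ι → E)
    (hα : 1 < α) (hs : ∀ i j, i ≠ j → 2 * α ≤ dist (c i) (c j)) {ε : ℝ} (hε : 0 < ε) :
    ∃ γ > 0, ∀ x i, ‖x - c i‖ ≤ 1 → ε ≤ ‖x - c i‖ →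
      ∑ j, meanContribution μ α (x - c j) ≤ meanContribution μ α 0 - γ := by
  set S : Set E := ⋃ i, closedBall (c i) 1 ∩ {x | ε ≤ ‖x - c i‖} with hS
  have hSc : IsCompact S := isCompact_iUnion fun i =>
    (isCompact_closedBall _ _).inter_right (isClosed_le continuous_const (by fun_prop))
  have hmem : ∀ x i, ‖x - c i‖ ≤ 1 → ε ≤ ‖x - c i‖ → x ∈ S := fun x i h1 h2 =>
    mem_iUnion.2 ⟨i, by rwa [mem_closedBall, dist_eq_norm], h2⟩
  have hcont : Continuous fun x => ∑ j, meanContribution μ α (x - c j) :=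
    continuous_finsetSum _ fun j _ =>
      (continuous_meanContribution μ α).comp (continuous_id.sub continuous_const)
  rcases S.eq_empty_or_nonempty with h | h
  · exact ⟨1, one_pos, fun x i h1 h2 => absurd (hmem x i h1 h2) (by simp [h])⟩
  obtain ⟨x₀, hx₀, hmax⟩ := hSc.exists_isMaxOn h hcont.continuousOn
  -- The maximizer is not a center: it is at least `ε` from the center of its ball, and other
  -- centers lie outside that ball. The deficit there serves as `γ`.
  have hlt : ∑ j, meanContribution μ α (x₀ - c j) < meanContribution μ α 0 := by
    refine sum_meanContribution_lt ν hpm hp hμ (fun j => x₀ - c j) hα.le (fun i j hij => ?_)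
      (fun i j hij => ?_) fun j hj => ?_
    · rw [dist_sub_left]
      exact hs i j hij
    · rw [dist_sub_left]
      linarith [hs i j hij]
    · obtain ⟨i, hi1, hi2⟩ := mem_iUnion.1 hx₀
      rw [sub_eq_zero.1 hj] at hi1 hi2
      by_cases hij : i = j
      · subst hij
        simp only [sub_self, norm_zero, mem_ofPred_eq] at hi2
        linarith
      · rw [mem_closedBall, dist_comm] at hi1
        linarith [hs i j hij]
  refine ⟨_, sub_pos.2 hlt, fun x i h1 h2 => ?_⟩
  have := hmax (hmem x i h1 h2)
  simp only [mem_ofPred_eq] at this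
  linarith

end Contribution

end Population

/-! ### Almost sure absence of ties -/

section Ties

variable {E : Type*} [NormedAddCommGroup E] [NormedSpace ℝ E] [StrictConvexSpace ℝ E]

/-- Both `y` and `y + t • w - w` lie on the segment from `y - w` to `y + t • w`, with complementary
weights. Adding the two convexity inequalities for the norm gives the claim; the one at `y` is
strict off the line. -/
theorem norm_sub_norm_sub_lt_of_notMem_span {y w : E} (hw : w ≠ 0)
    (hy : y ∉ Submodule.span ℝ {w}) {t : ℝ} (ht : 0 < t) :
    ‖y‖ - ‖y - w‖ < ‖y + t • w‖ - ‖y + t • w - w‖ := by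
  have hray : ¬ SameRay ℝ (t • (y - w)) (y + t • w) := by
    rintro (h | h | ⟨r₁, r₂, hr₁, hr₂, h⟩)
    · have h1 : y = w := sub_eq_zero.1 ((smul_eq_zero.1 h).resolve_left ht.ne')
      exact hy (by rw [h1]; exact Submodule.mem_span_singleton_self w)
    · refine hy (Submodule.mem_span_singleton.2 ⟨-t, ?_⟩)
      rw [neg_smul]
      exact (eq_neg_of_add_eq_zero_left h).symm
    · have h1 : (r₁ * t - r₂) • y = (r₁ * t + r₂ * t) • w := by
        rw [smul_smul, smul_sub, smul_add, smul_smul] at h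
        rw [sub_smul, add_smul, sub_eq_iff_eq_add, add_assoc, add_comm (_ • w), ← sub_eq_iff_eq_add,
          h, add_comm]
      rcases eq_or_ne (r₁ * t - r₂) 0 with h2 | h2
      · rw [h2, zero_smul] at h1
        rcases smul_eq_zero.1 h1.symm with h3 | h3
        · have : 0 < r₁ * t + r₂ * t := by positivity
          linarith
        · exact hw h3
      · refine hy (Submodule.mem_span_singleton.2 ⟨(r₁ * t - r₂)⁻¹ * (r₁ * t + r₂ * t), ?_⟩)
        rw [mul_smul, ← h1, inv_smul_smul₀ h2]
  have h1 : (1 + t) * ‖y‖ < t * ‖y - w‖ + ‖y + t • w‖ := by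
    have h := norm_add_lt_of_not_sameRay hray
    rw [show t • (y - w) + (y + t • w) = (1 + t) • y by module, norm_smul, norm_smul,
      Real.norm_of_nonneg ht.le, Real.norm_of_nonneg (by positivity)] at h
    exact h
  have h2 : (1 + t) * ‖y + t • w - w‖ ≤ ‖y - w‖ + t * ‖y + t • w‖ := by
    have h := norm_add_le (y - w) (t • (y + t • w))
    rw [show y - w + t • (y + t • w) = (1 + t) • (y + t • w - w) by module, norm_smul, norm_smul,
      Real.norm_of_nonneg ht.le, Real.norm_of_nonneg (by positivity)] at h
    exact h
  have h3 : 0 < (1 + t) * ((‖y + t • w‖ - ‖y + t • w - w‖) - (‖y‖ - ‖y - w‖)) := by linarith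
  linarith [pos_of_mul_pos_right h3 (by positivity)]

variable [FiniteDimensional ℝ E] [MeasurableSpace E] [BorelSpace E]

open scoped Pointwise in
/-- The points with prescribed difference of distances to two given points form a null set. -/
theorem addHaar_norm_sub_sub_norm_sub_eq (ν : Measure E) [ν.IsAddHaarMeasure]
    (hE : 1 < Module.finrank ℝ E) {a b : E} (hab : a ≠ b) (s : ℝ) :
    ν {x | ‖a - x‖ - ‖b - x‖ = s} = 0 := by
  set w := b - a with hw
  have hw0 : w ≠ 0 := sub_ne_zero.2 hab.symm
  set L : AffineSubspace ℝ E := AffineSubspace.mk' a (Submodule.span ℝ {w}) with hL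
  have hL0 : ν L = 0 := by
    refine Measure.addHaar_affineSubspace ν L fun h => ?_
    have h1 : L.direction = ⊤ := by rw [h, AffineSubspace.direction_top]
    rw [hL, AffineSubspace.direction_mk'] at h1
    have h2 := finrank_span_singleton (K := ℝ) hw0
    rw [h1, finrank_top] at h2
    omega
  have hmemL : ∀ x, x ∈ (L : Set E) ↔ x - a ∈ Submodule.span ℝ {w} := fun x =>
    AffineSubspace.mem_mk'
  set S : Set E := {x | ‖a - x‖ - ‖b - x‖ = s} \ L with hS
  have hSm : MeasurableSet S :=
    (measurableSet_eq_fun (by fun_prop) measurable_const).diff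
      (AffineSubspace.closed_of_finiteDimensional L).measurableSet
  have hstep : ∀ x ∈ S, ∀ t : ℝ, 0 < t → x + t • w ∉ S := by
    intro x hx t ht hxt
    have h1 := norm_sub_norm_sub_lt_of_notMem_span hw0 (fun h => hx.2 ((hmemL x).2 h)) ht
    have h2 : ‖a - x‖ - ‖b - x‖ = s := hx.1
    have h3 : ‖a - (x + t • w)‖ - ‖b - (x + t • w)‖ = s := hxt.1
    rw [norm_sub_rev a, norm_sub_rev b] at h2 h3
    rw [show x - a - w = x - b by rw [hw]; abel,
      show x - a + t • w = x + t • w - a by abel,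
      show x + t • w - a - w = x + t • w - b by rw [hw]; abel] at h1
    linarith
  -- By `hstep`, lines parallel to `w` meet `S` at most once, so the translates by `w / (n + 1)` are
  -- infinitely many disjoint copies with bounded shifts.
  have hS0 : ν S = 0 := by
    refine Measure.addHaar_eq_zero_of_disjoint_translates ν
      (fun n : ℕ => (1 / ((n : ℝ) + 1)) • w) ?_ ?_ hSm
    · refine (Metric.isBounded_iff_subset_closedBall 0).2 ⟨‖w‖, ?_⟩
      rintro _ ⟨n, rfl⟩
      rw [mem_closedBall_zero_iff, norm_smul, Real.norm_of_nonneg (by positivity)]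
      refine mul_le_of_le_one_left (norm_nonneg _) ?_
      rw [div_le_one (by positivity)]
      linarith [n.cast_nonneg (α := ℝ)]
    · have key : ∀ n m : ℕ, n < m →
          Disjoint (({(1 / ((n : ℝ) + 1)) • w} : Set E) + S)
            (({(1 / ((m : ℝ) + 1)) • w} : Set E) + S) := by
        intro n m hnm
        rw [Set.disjoint_left]
        intro z hz hz'
        rw [Set.singleton_add] at hz hz'
        obtain ⟨x, hx, rfl⟩ := hz
        obtain ⟨x', hx', h⟩ := hz'
        refine hstep x hx (1 / ((n : ℝ) + 1) - 1 / ((m : ℝ) + 1)) ?_ ?_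
        · rw [sub_pos]
          exact one_div_lt_one_div_of_lt (by positivity) (by simpa using hnm)
        · have h1 : x' = x + (1 / ((n : ℝ) + 1) - 1 / ((m : ℝ) + 1)) • w := by
            simp only at h
            rw [sub_smul, eq_sub_of_add_eq' h]
            abel
          rwa [← h1]
      intro n m hnm
      rcases lt_or_gt_of_ne hnm with h | h
      · exact key n m h
      · exact (key m n h).symm
  refine measure_mono_null (fun x hx => ?_) (measure_union_null hS0 hL0)
  by_cases h : x ∈ (L : Set E)
  · exact Or.inr h
  · exact Or.inl ⟨hx, h⟩

/-- A measurable set with null sections in one coordinate is null for the product measure. -/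
theorem measure_pi_eq_zero_of_update {ι : Type*} [Fintype ι] [DecidableEq ι] {X : ι → Type*}
    [∀ i, MeasurableSpace (X i)] (μ : ∀ i, Measure (X i)) [∀ i, SigmaFinite (μ i)]
    {S : Set (∀ i, X i)} (hS : MeasurableSet S) (a : ι)
    (h : ∀ v, μ a {x | Function.update v a x ∈ S} = 0) : Measure.pi μ S = 0 := by
  rcases isEmpty_or_nonempty (∀ i, X i) with he | ⟨⟨v₀⟩⟩
  · rw [Set.eq_empty_of_isEmpty S, measure_empty]
  have hm : Measurable (S.indicator (1 : (∀ i, X i) → ENNReal)) := measurable_one.indicator hS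
  rw [← lintegral_indicator_one hS, lintegral_eq_lmarginal_univ v₀,
    lmarginal_erase' _ hm (Finset.mem_univ a)]
  have h0 : (fun v => ∫⁻ x, S.indicator (1 : (∀ i, X i) → ENNReal) (Function.update v a x) ∂μ a)
      = fun _ => 0 := by
    ext v
    exact (lintegral_indicator_one (measurable_update v hS)).trans (h v)
  rw [h0]
  simp [lmarginal]

/-- Almost surely no two sample points of the same ball have the same total distance to the sample
points of that ball. -/
theorem ae_sum_norm_sub_ne (ν : Measure E) [ν.IsAddHaarMeasure] (hE : 1 < Module.finrank ℝ E)
    {μ : Measure E} [SigmaFinite μ] (hμ : μ ≪ ν) {k n : ℕ} (hn : 3 ≤ n) :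
    ∀ᵐ v ∂(Measure.pi fun _ : Fin k × Fin n => μ), ∀ i l l', l ≠ l' →
      ∑ l'', ‖v (i, l) - v (i, l'')‖ ≠ ∑ l'', ‖v (i, l') - v (i, l'')‖ := by
  have : Nontrivial E := Module.nontrivial_of_finrank_pos (R := ℝ) (by omega)
  rw [ae_all_iff]; intro i
  rw [ae_all_iff]; intro l
  rw [ae_all_iff]; intro l'
  rw [ae_all_iff]; intro hll'
  -- Here `3 ≤ n` matters: with all other points fixed, a tie confines this third point to a level
  -- set of a difference of two distances. Coincident points are treated separately in `h1`.
  obtain ⟨l₀, hl₀⟩ : ∃ l₀, l₀ ∉ ({l, l'} : Finset (Fin n)) := by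
    by_contra! h
    have h1 : (Finset.univ : Finset (Fin n)).card ≤ ({l, l'} : Finset (Fin n)).card :=
      Finset.card_le_card fun x _ => h x
    have h2 := Finset.card_le_two (a := l) (b := l')
    rw [Finset.card_univ, Fintype.card_fin] at h1
    omega
  simp only [Finset.mem_insert, Finset.mem_singleton, not_or] at hl₀
  have h1 : (Measure.pi fun _ : Fin k × Fin n => μ) {v | v (i, l) = v (i, l')} = 0 := by
    refine measure_pi_eq_zero_of_update _ (measurableSet_eq_fun (by fun_prop) (by fun_prop)) (i, l)
      fun v => ?_
    have hne : (i, l') ≠ (i, l) := fun h => hll' (Prod.mk.inj h).2.symm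
    simp only [Set.mem_ofPred_eq, Function.update_self, Function.update_of_ne hne]
    exact hμ (measure_singleton _)
  have h2 : (Measure.pi fun _ : Fin k × Fin n => μ) {v | v (i, l) ≠ v (i, l') ∧
      ∑ l'', ‖v (i, l) - v (i, l'')‖ = ∑ l'', ‖v (i, l') - v (i, l'')‖} = 0 := by
    refine measure_pi_eq_zero_of_update _ (MeasurableSet.inter
      (measurableSet_eq_fun (by fun_prop) (by fun_prop)).compl
      (measurableSet_eq_fun (by fun_prop) (by fun_prop))) (i, l₀) fun v => ?_
    have hne : ∀ q, q ≠ l₀ → (i, q) ≠ (i, l₀) := fun q hq h => hq (Prod.mk.inj h).2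
    by_cases hv : v (i, l) = v (i, l')
    · simp [Function.update_of_ne (hne l (Ne.symm hl₀.1)),
        Function.update_of_ne (hne l' (Ne.symm hl₀.2)), hv]
    · refine measure_mono_null (fun x hx => ?_) (hμ (addHaar_norm_sub_sub_norm_sub_eq ν hE hv
        (∑ q ∈ Finset.univ.erase l₀, (‖v (i, l') - v (i, q)‖ - ‖v (i, l) - v (i, q)‖))))
      have hx2 : ∑ q, ‖Function.update v (i, l₀) x (i, l) - Function.update v (i, l₀) x (i, q)‖
          = ∑ q, ‖Function.update v (i, l₀) x (i, l') - Function.update v (i, l₀) x (i, q)‖ := hx.2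
      have hsplit : ∀ (u : Fin k × Fin n → E) (y : E), ∑ q, ‖y - u (i, q)‖
          = ‖y - u (i, l₀)‖ + ∑ q ∈ Finset.univ.erase l₀, ‖y - u (i, q)‖ := fun u y =>
        (Finset.add_sum_erase _ _ (Finset.mem_univ l₀)).symm
      rw [hsplit, hsplit] at hx2
      rw [Function.update_of_ne (hne l (Ne.symm hl₀.1)),
        Function.update_of_ne (hne l' (Ne.symm hl₀.2)), Function.update_self] at hx2
      have hc : ∀ y : E, ∑ q ∈ Finset.univ.erase l₀, ‖y - Function.update v (i, l₀) x (i, q)‖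
          = ∑ q ∈ Finset.univ.erase l₀, ‖y - v (i, q)‖ := fun y =>
        Finset.sum_congr rfl fun q hq => by
          rw [Function.update_of_ne (hne q (Finset.ne_of_mem_erase hq))]
      rw [hc, hc] at hx2
      rw [Set.mem_ofPred_eq, Finset.sum_sub_distrib]
      linarith
  refine measure_mono_null (fun v hv => ?_) (measure_union_null h1 h2)
  rw [Set.mem_compl_iff, Set.mem_ofPred_eq, not_not] at hv
  by_cases h : v (i, l) = v (i, l')
  · exact Or.inl h
  · exact Or.inr ⟨h, hv⟩

end Ties

/-! ### Laws of large numbers -/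

section LargeNumbers

open Filter Topology ProbabilityTheory

/-- Weak law of large numbers for the sample points of one ball. -/
theorem tendsto_measure_pi_sum_sub_ge {X : Type*} [MeasurableSpace X] (μ : Measure X)
    [IsProbabilityMeasure μ] {φ : X → ℝ} (hφ : MemLp φ 2 μ) {k : ℕ} (i : Fin k) {η : ℝ}
    (hη : 0 < η) :
    Tendsto (fun n : ℕ => (Measure.pi fun _ : Fin k × Fin n => μ)
      {v | n * η ≤ |∑ l, φ (v (i, l)) - n * ∫ x, φ x ∂μ|}) atTop (𝓝 0) := by
  have hbound : ∀ n : ℕ, 0 < n → (Measure.pi fun _ : Fin k × Fin n => μ)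
      {v | n * η ≤ |∑ l, φ (v (i, l)) - n * ∫ x, φ x ∂μ|}
        ≤ ENNReal.ofReal (Var[φ; μ] / η ^ 2 / n) := by
    intro n hn
    have hn' : (0 : ℝ) < n := Nat.cast_pos.2 hn
    set P := Measure.pi fun _ : Fin k × Fin n => μ with hP
    -- Zero on the coordinates of the other balls, so that variances over the full product count
    -- only the `n` points of ball `i`.
    set Y : Fin k × Fin n → X → ℝ := fun q => if q.1 = i then φ else 0 with hY
    have hYL : ∀ q, MemLp (Y q) 2 μ := by
      intro q
      simp only [hY]
      split_ifs
      · exact hφ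
      · exact MemLp.zero
    have hsum : ∀ v : Fin k × Fin n → X,
        (∑ q, fun w : Fin k × Fin n → X => Y q (w q)) v = ∑ l, φ (v (i, l)) := by
      intro v
      rw [Finset.sum_apply, Fintype.sum_prod_type, Finset.sum_eq_single i]
      · simp [hY]
      · intro j _ hj
        simp [hY, hj]
      · simp
    have hvar : Var[∑ q, fun w : Fin k × Fin n → X => Y q (w q); P] = n * Var[φ; μ] := by
      rw [hP, variance_sum_pi hYL, Fintype.sum_prod_type, Finset.sum_eq_single i]
      · simp [hY]
      · intro j _ hj
        simp [hY, hj]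
      · simp
    have hmem : MemLp (∑ q, fun w : Fin k × Fin n → X => Y q (w q)) 2 P :=
      memLp_finsetSum' _ fun q _ =>
        (hYL q).comp_measurePreserving (measurePreserving_eval (fun _ => μ) q)
    have hint : ∀ q, ∫ w, Y q (w q) ∂P = ∫ x, Y q x ∂μ := fun q =>
      integral_comp_eval (hYL q).aestronglyMeasurable
    have hmean : P[∑ q, fun w : Fin k × Fin n → X => Y q (w q)] = n * ∫ x, φ x ∂μ := by
      simp only [Finset.sum_apply]
      rw [integral_finsetSum _ fun q _ => ?_]
      · simp only [hint]
        rw [Fintype.sum_prod_type, Finset.sum_eq_single i]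
        · simp [hY]
        · intro j _ hj
          simp [hY, hj]
        · simp
      · exact ((hYL q).comp_measurePreserving
          (measurePreserving_eval (fun _ => μ) q)).integrable one_le_two
    have h := meas_ge_le_variance_div_sq hmem (c := n * η) (by positivity)
    rw [hmean, hvar] at h
    simp only [hsum] at h
    refine h.trans (ENNReal.ofReal_le_ofReal (le_of_eq ?_))
    field_simp
  refine tendsto_of_tendsto_of_tendsto_of_le_of_le' tendsto_const_nhds ?_
    (Eventually.of_forall fun _ => zero_le) ((eventually_gt_atTop 0).mono hbound)
  rw [← ENNReal.ofReal_zero]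
  exact ENNReal.tendsto_ofReal (tendsto_const_div_atTop_nhds_zero_nat _)

variable {E : Type*} [NormedAddCommGroup E] [MeasurableSpace E]

/-- If no sample point falls in the ball, the count of its indicator deviates from its expectation
by the full `n * μ (ball)`; the weak law excludes this. -/
theorem tendsto_measure_pi_forall_norm_gt [BorelSpace E] (μ : Measure E) [IsProbabilityMeasure μ]
    {η : ℝ} (hμ : 0 < μ (Metric.closedBall 0 η)) {k : ℕ} (i : Fin k) :
    Tendsto (fun n : ℕ => (Measure.pi fun _ : Fin k × Fin n => μ)
      {v | ∀ l, η < ‖v (i, l)‖}) atTop (𝓝 0) := by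
  have hB : MeasurableSet (Metric.closedBall (0 : E) η) := Metric.isClosed_closedBall.measurableSet
  have hpos : 0 < μ.real (Metric.closedBall 0 η) :=
    ENNReal.toReal_pos hμ.ne' (measure_ne_top _ _)
  refine tendsto_of_tendsto_of_tendsto_of_le_of_le tendsto_const_nhds
    (tendsto_measure_pi_sum_sub_ge μ (φ := (Metric.closedBall (0 : E) η).indicator 1)
      (memLp_indicator_const 2 hB 1 (Or.inr (measure_ne_top _ _))) i hpos)
    (fun _ => zero_le) fun n => measure_mono fun v hv => ?_
  have h0 : ∑ l, (Metric.closedBall (0 : E) η).indicator (1 : E → ℝ) (v (i, l)) = 0 := by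
    refine Finset.sum_eq_zero fun l _ => Set.indicator_of_notMem ?_ _
    rw [mem_closedBall_zero_iff, not_le]
    exact hv l
  rw [Set.mem_ofPred_eq, h0, integral_indicator_one hB, zero_sub, abs_neg]
  exact le_abs_self _

/-- Both averages are 1-Lipschitz in `x`, so the weak law on a finite `η / 3`-net of `K` controls
all of `K`. -/
theorem tendsto_measure_pi_not_uniform [NormedSpace ℝ E] [FiniteDimensional ℝ E] [BorelSpace E]
    (μ : Measure E) [IsProbabilityMeasure μ] (α : ℝ) {K : Set E} (hK : IsCompact K) {η : ℝ}
    (hη : 0 < η) {k : ℕ} (i : Fin k) :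
    Tendsto (fun n : ℕ => (Measure.pi fun _ : Fin k × Fin n => μ)
      {v | ¬ ∀ x ∈ K, |∑ l, max (α - ‖x - v (i, l)‖) 0 - n * meanContribution μ α x| ≤ n * η})
      atTop (𝓝 0) := by
  obtain ⟨t, -, htf, ht⟩ := hK.finite_cover_balls (show 0 < η / 3 by positivity)
  have hlim : Tendsto (fun n : ℕ => ∑ y ∈ htf.toFinset, (Measure.pi fun _ : Fin k × Fin n => μ)
      {v | n * (η / 3) ≤ |∑ l, max (α - ‖y - v (i, l)‖) 0 - n * ∫ v, max (α - ‖y - v‖) 0 ∂μ|})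
      atTop (𝓝 0) := by
    rw [show (0 : ENNReal) = ∑ y ∈ htf.toFinset, 0 by simp]
    refine tendsto_finsetSum _ fun y _ => tendsto_measure_pi_sum_sub_ge μ
      (φ := fun v => max (α - ‖y - v‖) 0) ?_ i (by positivity)
    refine MemLp.of_bound (by fun_prop) |α| (ae_of_all _ fun v => ?_)
    rw [Real.norm_of_nonneg (le_max_right _ _)]
    exact max_le (by linarith [le_abs_self α, norm_nonneg (y - v)]) (abs_nonneg _)
  refine tendsto_of_tendsto_of_tendsto_of_le_of_le tendsto_const_nhds hlim (fun _ => zero_le)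
    fun n => (measure_mono fun v hv => ?_).trans (measure_biUnion_finset_le _ _)
  rw [Set.mem_ofPred_eq] at hv
  push Not at hv
  obtain ⟨x, hx, hxv⟩ := hv
  obtain ⟨y, hy, hxy⟩ := Set.mem_iUnion₂.1 (ht hx)
  refine Set.mem_iUnion₂.2 ⟨y, htf.mem_toFinset.2 hy, ?_⟩
  rw [Metric.mem_ball, dist_eq_norm] at hxy
  have h1 : |∑ l, max (α - ‖x - v (i, l)‖) 0 - ∑ l, max (α - ‖y - v (i, l)‖) 0| ≤ n * (η / 3) := by
    rw [← Finset.sum_sub_distrib]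
    refine (Finset.abs_sum_le_sum_abs _ _).trans ?_
    refine (Finset.sum_le_card_nsmul _ _ (η / 3) fun l _ =>
      (abs_contribution_sub_le α x y _).trans hxy.le).trans ?_
    simp
  have h2 : |n * meanContribution μ α x - n * meanContribution μ α y| ≤ n * (η / 3) := by
    rw [← mul_sub, abs_mul, Nat.abs_cast]
    gcongr
    exact (abs_meanContribution_sub_le μ α x y).trans hxy.le
  change _ ≤ |_ - n * meanContribution μ α y|
  by_contra! h3
  rw [abs_le] at h1 h2
  rw [abs_lt] at h3
  refine absurd hxv (not_lt.2 (abs_le.2 ⟨?_, ?_⟩)) <;> linarith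

end LargeNumbers

/-! ### Choice of constants and conclusion -/

open Filter Topology in
theorem mainTheorem7 (m : ℕ) (hm : 2 ≤ m) (k : ℕ) (hk : 1 ≤ k)
    (c : Fin k → EuclideanSpace ℝ (Fin m))
    (μ : Measure (EuclideanSpace ℝ (Fin m))) [IsProbabilityMeasure μ]
    (hball : μ (Metric.closedBall 0 1)ᶜ = 0)
    (ha1 : KMedian.RotationInvariant μ)
    (ha2 : KMedian.PositiveNearCenter μ)
    (ha3 : KMedian.NullOnLebesgueNull μ)
    (p : EuclideanSpace ℝ (Fin m) → ENNReal) (hp : Measurable p)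
    (hdensity : μ = (volume.restrict (Metric.closedBall 0 1)).withDensity p)
    (hdecreasing : ∀ x₁ ∈ Metric.closedBall (0 : EuclideanSpace ℝ (Fin m)) 1,
      ∀ x₂ ∈ Metric.closedBall (0 : EuclideanSpace ℝ (Fin m)) 1, ‖x₁‖ < ‖x₂‖ → p x₂ < p x₁)
    (hsep : ∀ i j, i ≠ j → 2 < dist (c i) (c j)) :
    KMedian.WithHighProbability (fun n => KMedian.sampleLaw k n μ)
      (fun n => KMedian.recoveryEvent n c) := by
  have hfr : 1 < Module.finrank ℝ (EuclideanSpace ℝ (Fin m)) := by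
    rw [finrank_euclideanSpace_fin]; omega
  have : Nontrivial (EuclideanSpace ℝ (Fin m)) :=
    Module.nontrivial_of_finrank_pos (R := ℝ) (by omega)
  have hμvol : μ ≪ volume := by
    rw [hdensity]
    exact (withDensity_absolutelyContinuous _ _).trans Measure.restrict_le_self.absolutelyContinuous
  obtain ⟨ε, hε, hsepε⟩ : ∃ ε : ℝ, 0 < ε ∧ ∀ i j, i ≠ j → 2 + 4 * ε ≤ dist (c i) (c j) := by
    have h1 : ∀ᶠ ε : ℝ in 𝓝[>] 0, ∀ i j, i ≠ j → 2 + 4 * ε ≤ dist (c i) (c j) := by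
      refine Eventually.filter_mono nhdsWithin_le_nhds ?_
      refine eventually_all.2 fun i => eventually_all.2 fun j => eventually_all.2 fun hij => ?_
      have h2 : Tendsto (fun ε : ℝ => 2 + 4 * ε) (𝓝 0) (𝓝 (2 + 4 * 0)) :=
        Continuous.tendsto (by fun_prop) 0
      exact h2.eventually_le_const (by linarith [hsep i j hij])
    obtain ⟨ε, h2, h3⟩ := (h1.and self_mem_nhdsWithin).exists
    exact ⟨ε, h3, h2⟩
  have hα : ∀ i j, i ≠ j → 2 * (1 + 2 * ε) ≤ dist (c i) (c j) := fun i j hij => by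
    linarith [hsepε i j hij]
  obtain ⟨γ, hγ, hgap⟩ := exists_gap_sum_meanContribution volume hp hdecreasing hdensity c
    (show 1 < 1 + 2 * ε by linarith) hα hε
  have hg0 : ∀ x, meanContribution μ (1 + 2 * ε) x ≤ meanContribution μ (1 + 2 * ε) 0 := by
    intro x
    simpa using sum_meanContribution_le (α := 1 + 2 * ε) volume hp hdecreasing hdensity
      (fun _ : Unit => x) (fun i j hij => absurd (Subsingleton.elim i j) hij)
      (fun i j hij => absurd (Subsingleton.elim i j) hij)
  obtain ⟨η, hη, hηε, hηγ⟩ : ∃ η : ℝ, 0 < η ∧ 2 * η < ε ∧ 3 * k * η < γ := by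
    have h1 : ∀ᶠ η : ℝ in 𝓝[>] 0, 2 * η < ε ∧ 3 * k * η < γ := by
      refine Eventually.filter_mono nhdsWithin_le_nhds (Eventually.and ?_ ?_)
      · have h2 : Tendsto (fun η : ℝ => 2 * η) (𝓝 0) (𝓝 (2 * 0)) :=
          Continuous.tendsto (by fun_prop) 0
        exact h2.eventually_lt_const (by simpa using hε)
      · have h2 : Tendsto (fun η : ℝ => 3 * k * η) (𝓝 0) (𝓝 (3 * k * 0)) :=
          Continuous.tendsto (by fun_prop) 0
        exact h2.eventually_lt_const (by simpa using hγ)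
    obtain ⟨η, h2, h3⟩ := (h1.and self_mem_nhdsWithin).exists
    exact ⟨η, h3, h2⟩
  -- All positions, relative to any center, that a point of any ball can take.
  set K : Set (EuclideanSpace ℝ (Fin m)) := ⋃ i, ⋃ j, Metric.closedBall (c i - c j) 1 with hK
  have hKc : IsCompact K :=
    isCompact_iUnion fun i => isCompact_iUnion fun j => isCompact_closedBall _ _
  have hμη : 0 < μ (Metric.closedBall 0 η) :=
    (ha2 _ Metric.isOpen_ball (Metric.mem_ball_self hη)).trans_le
      (measure_mono (Set.inter_subset_left.trans Metric.ball_subset_closedBall))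
  set U : ∀ n : ℕ, Fin k → Set (Fin k × Fin n → EuclideanSpace ℝ (Fin m)) := fun n i =>
    {v | ¬ ∀ x ∈ K, |∑ l, max (1 + 2 * ε - ‖x - v (i, l)‖) 0
      - n * meanContribution μ (1 + 2 * ε) x| ≤ n * η} with hU
  set V : ∀ n : ℕ, Fin k → Set (Fin k × Fin n → EuclideanSpace ℝ (Fin m)) := fun n i =>
    {v | ∀ l, η < ‖v (i, l)‖} with hV
  have hlim : Tendsto (fun n : ℕ => ∑ i, KMedian.sampleLaw k n μ (U n i)
      + ∑ i, KMedian.sampleLaw k n μ (V n i)) atTop (𝓝 0) := by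
    rw [show (0 : ENNReal) = ∑ _i : Fin k, 0 + ∑ _i : Fin k, 0 by simp]
    exact (tendsto_finsetSum _ fun i _ => tendsto_measure_pi_not_uniform μ _ hKc hη i).add
      (tendsto_finsetSum _ fun i _ => tendsto_measure_pi_forall_norm_gt μ hμη i)
  intro δ hδ _
  obtain ⟨N, hN⟩ := eventually_atTop.1
    ((hlim.eventually_lt_const (ENNReal.ofReal_pos.2 hδ)).and (eventually_ge_atTop 3))
  refine ⟨N, fun n hn => lt_of_le_of_lt ?_ (hN n hn.le).1⟩
  have hn3 : 3 ≤ n := (hN n hn.le).2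
  have hties : ∀ᵐ v ∂(KMedian.sampleLaw k n μ), ∀ i l l', l ≠ l' →
      ∑ l'', ‖v (i, l) - v (i, l'')‖ ≠ ∑ l'', ‖v (i, l') - v (i, l'')‖ :=
    ae_sum_norm_sub_ne volume hfr hμvol hn3
  have hnorm : ∀ᵐ v ∂(KMedian.sampleLaw k n μ), ∀ q, ‖v q‖ ≤ 1 := by
    refine ae_all_iff.2 fun q => ?_
    have h1 : ∀ᵐ x ∂μ, ‖x‖ ≤ 1 := by
      refine measure_mono_null (fun x hx => ?_) hball
      simpa using hx
    exact (measurePreserving_eval (fun _ : Fin k × Fin n => μ) q).quasiMeasurePreserving.ae h1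
  calc KMedian.sampleLaw k n μ (KMedian.recoveryEvent n c)ᶜ
      ≤ KMedian.sampleLaw k n μ ((⋃ i, U n i) ∪ ⋃ i, V n i) := by
        -- Outside the null events of ties and of points beyond the unit ball, failure of recovery
        -- forces some `U n i` or `V n i`.
        refine measure_mono_ae ?_
        filter_upwards [hties, hnorm] with v hv1 hv2 hv
        by_contra hcon
        refine hv (mem_recoveryEvent_of_approx (by omega) c v (meanContribution μ (1 + 2 * ε)) hηε hη
          hηγ hsepε hv2 (fun i j h x hx => ?_) (fun i => ?_) hg0 hgap hv1)
        · by_contra h1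
          refine hcon (Or.inl (Set.mem_iUnion.2 ⟨i, fun h2 => h1 (h2 x ?_)⟩))
          exact Set.mem_iUnion₂.2 ⟨j, h, by rwa [Metric.mem_closedBall, dist_eq_norm]⟩
        · by_contra! h1
          exact hcon (Or.inr (Set.mem_iUnion.2 ⟨i, h1⟩))
    _ ≤ _ := (measure_union_le _ _).trans
        (add_le_add (measure_iUnion_fintype_le _ _) (measure_iUnion_fintype_le _ _))
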